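/- **Definitions.** All graphs are finite and simple. The unit sphere $S(x)$ of a vertex $x$ is the graph generated (induced) by the neighbors of $x$, and $G-x$ is the graph generated by the other vertices. A graph is *contractible* if it is the one-point graph or has a vertex $x$ such that $S(x)$ and $G-x$ are contractible. The empty graph is the $(-1)$-sphere. For $d\ge 0$, a *$d$-manifold* is a graph all of whose unit spheres are $(d-1)$-spheres, and a *$d$-sphere* is a $d$-manifold $G$ such that $G-x$ is contractible for some vertex $x$. The same inductive definitions are used for a finite abstract simplicial complex $K$, where the unit sphere of a vertex $x$ is its link (all simplices $\sigma\not\ni x$ with $\sigma\cup\{x\}\in K$) and $K-x$ consists of the simplices of $K$ not containing $x$; a graph is contractible, a $d$-sphere or a $d$-manifold if and only if the complex of its complete subgraphs is. The empty complex is the $(-1)$-sphere, and it also counts as a $d$-manifold for every $d\ge 0$. Let $d\ge 1$ and let $G$ be a $d$-manifold or a $d$-sphere. A $(d-2)$-simplex $\{x_0,\dots,x_{d-2}\}$ of $G$ (a complete subgraph with $d-1$ vertices) is *odd* if its dual circle $S(x_0)\cap\dots\cap S(x_{d-2})$ has an odd number of vertices. The *Fisk variety* $O(G)$ is the simplicial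 complex generated by the odd $(d-2)$-simplices: its simplices are the non-empty subsets of odd $(d-2)$-simplices. (If $d=1$, then $O(G)$ is empty.) For a vertex $x$ of a $d$-manifold $M$, the Fisk set $O(S(x))$ is that of the $(d-1)$-sphere $S(x)$. **Theorem.** Let $d\ge 2$ and let $M$ be a $d$-manifold. Then the following are equivalent: 1. for every vertex $x$ of $M$, the Fisk set $O(S(x))$ is either empty or a $(d-3)$-sphere; 2. the Fisk variety $O(M)$ is a $(d-2)$-manifold (possibly empty). -/

import Mathlib

namespace Fisk

universe u

/-! ### Discrete manifolds: the inductive definitions for graphs -/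

/-- The unit sphere `S(x)`: the graph generated by the neighbors of `x`. -/
abbrev unitSphere {V : Type u} (G : SimpleGraph V) (x : V) : SimpleGraph (G.neighborSet x) :=
  G.induce (G.neighborSet x)

/-- The graph `G - x` generated by all vertices different from `x`. -/
abbrev removeVertex {V : Type u} (G : SimpleGraph V) (x : V) :
    SimpleGraph ({x}ᶜ : Set V) :=
  G.induce ({x}ᶜ : Set V)

/-- A graph is contractible if it is the one-point graph, or if it has a vertex `x` such that
`S(x)` and `G - x` are both contractible. -/
inductive IsContractible : ∀ {V : Type u}, SimpleGraph V → Prop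
  | point {V : Type u} (G : SimpleGraph V) (x : V) (h : ∀ y : V, y = x) : IsContractible G
  | step {V : Type u} (G : SimpleGraph V) (x : V) (h₁ : IsContractible (unitSphere G x))
      (h₂ : IsContractible (removeVertex G x)) : IsContractible G

/-- The empty graph is the `(-1)`-sphere; for `d ≥ 0`, a `d`-sphere is a graph all of whose unit
spheres are `(d-1)`-spheres and which becomes contractible after the removal of some vertex. -/
inductive IsSphere : ℤ → ∀ {V : Type u}, SimpleGraph V → Prop
  | empty {V : Type u} (G : SimpleGraph V) (h : IsEmpty V) : IsSphere (-1) G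
  | step {V : Type u} (d : ℤ) (hd : 0 ≤ d) (G : SimpleGraph V)
      (h : ∀ y : V, IsSphere (d - 1) (unitSphere G y)) (x : V)
      (hx : IsContractible (removeVertex G x)) : IsSphere d G

/-- A `d`-manifold: every unit sphere is a `(d-1)`-sphere. -/
def IsManifold (d : ℤ) {V : Type u} (G : SimpleGraph V) : Prop :=
  ∀ x : V, IsSphere (d - 1) (unitSphere G x)

/-! ### The same inductive definitions for abstract simplicial complexes

The simplices are the non-empty faces; the vertices of `K` are the `x` with `{x} ∈ K`, so that
points of the ground type which are not in a face of `K` play no role. -/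

section Complex

variable {V : Type u}

open Classical in
/-- The unit sphere (link) of `x` in `K`: all simplices `σ` not containing `x` for which
`σ ∪ {x}` is a simplex of `K`. -/
def link (K : PreAbstractSimplicialComplex V) (x : V) : PreAbstractSimplicialComplex V where
  faces := {σ | σ.Nonempty ∧ x ∉ σ ∧ insert x σ ∈ K}
  isRelLowerSet_faces := by
    rintro σ ⟨h1, h2, h3⟩
    refine ⟨h1, fun τ hτ hn => ⟨hn, fun h => h2 (hτ h), ?_⟩⟩
    exact (K.isRelLowerSet_faces h3).2 (Finset.insert_subset_insert x hτ)
      (Finset.insert_nonempty x τ)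

/-- The complex `K - x` of all simplices of `K` which do not contain `x`. -/
def deletion (K : PreAbstractSimplicialComplex V) (x : V) : PreAbstractSimplicialComplex V where
  faces := {σ | σ ∈ K ∧ x ∉ σ}
  isRelLowerSet_faces := by
    rintro σ ⟨h1, h2⟩
    exact ⟨(K.isRelLowerSet_faces h1).1, fun τ hτ hn =>
      ⟨(K.isRelLowerSet_faces h1).2 hτ hn, fun h => h2 (hτ h)⟩⟩

/-- A complex is contractible if it is a one-point complex, or if it has a vertex `x` such that
the unit sphere of `x` and `K - x` are both contractible. -/
inductive IsContractibleComplex : PreAbstractSimplicialComplex V → Prop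
  | point (K : PreAbstractSimplicialComplex V) (x : V) (h : ∀ σ, σ ∈ K ↔ σ = {x}) :
      IsContractibleComplex K
  | step (K : PreAbstractSimplicialComplex V) (x : V) (hx : {x} ∈ K)
      (h₁ : IsContractibleComplex (link K x)) (h₂ : IsContractibleComplex (deletion K x)) :
      IsContractibleComplex K

/-- The empty complex is the `(-1)`-sphere; for `d ≥ 0`, a `d`-sphere is a complex in which the
unit spheres of all vertices are `(d-1)`-spheres and which becomes contractible after the removal
of some vertex. -/
inductive IsSphereComplex : ℤ → PreAbstractSimplicialComplex V → Prop
  | empty (K : PreAbstractSimplicialComplex V) (h : ∀ σ, σ ∉ K) : IsSphereComplex (-1) K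
  | step (d : ℤ) (hd : 0 ≤ d) (K : PreAbstractSimplicialComplex V)
      (h : ∀ y : V, {y} ∈ K → IsSphereComplex (d - 1) (link K y)) (x : V) (hxK : {x} ∈ K)
      (hx : IsContractibleComplex (deletion K x)) : IsSphereComplex d K

/-- A `d`-manifold: the unit sphere of every vertex is a `(d-1)`-sphere. -/
def IsManifoldComplex (d : ℤ) (K : PreAbstractSimplicialComplex V) : Prop :=
  ∀ x : V, {x} ∈ K → IsSphereComplex (d - 1) (link K x)

end Complex

/-! ### The Fisk variety -/

/-- The vertex set of the dual sphere `S(x₀) ∩ ⋯ ∩ S(xₖ)` of a simplex `x = {x₀, …, xₖ}`. For the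
empty simplex this is the set of all vertices. -/
def dualSphere {V : Type u} (G : SimpleGraph V) (x : Finset V) : Set V :=
  {y | ∀ v ∈ x, y ∈ G.neighborSet v}

/-- `x` is an odd `(d-2)`-simplex: a complete subgraph with `d-1` vertices whose dual circle has
odd length, that is, an odd number of vertices. -/
def IsOddSimplex (d : ℤ) {V : Type u} (G : SimpleGraph V) (x : Finset V) : Prop :=
  G.IsClique (x : Set V) ∧ (x.card : ℤ) = d - 1 ∧ Odd (dualSphere G x).ncard

/-- The Fisk variety `O(G)` of a graph `G` regarded as an object of dimension `d`: the simplicial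
complex generated by the odd `(d-2)`-simplices. -/
def fiskVariety (d : ℤ) {V : Type u} (G : SimpleGraph V) : PreAbstractSimplicialComplex V where
  faces := {σ | σ.Nonempty ∧ ∃ x, IsOddSimplex d G x ∧ σ ⊆ x}
  isRelLowerSet_faces := by
    rintro σ ⟨h, x, hx, hσ⟩
    exact ⟨h, fun τ hτ hn => ⟨hn, x, hx, Finset.Subset.trans hτ hσ⟩⟩

/-! ### The two sets of definitions agree

A graph is contractible, a sphere or a manifold if and only if its Whitney complex is. -/

section Whitney

/-- The Whitney complex of a graph: its simplices are the complete subgraphs. -/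
def whitney {V : Type u} (G : SimpleGraph V) : PreAbstractSimplicialComplex V where
  faces := {σ | σ.Nonempty ∧ G.IsClique (σ : Set V)}
  isRelLowerSet_faces := by
    rintro σ ⟨h, hc⟩
    exact ⟨h, fun τ hτ hn => ⟨hn, hc.subset (by exact_mod_cast hτ)⟩⟩

end Whitney

section Agreement
variable {V W : Type u}

theorem complex_ext {K L : PreAbstractSimplicialComplex V} (h : ∀ σ, σ ∈ K ↔ σ ∈ L) : K = L :=
  SetLike.ext h

open Classical in
theorem mem_map_iff (f : W → V) (K : PreAbstractSimplicialComplex W) (τ : Finset V) :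
    τ ∈ K.map f ↔ ∃ σ ∈ K, σ.image f = τ := Iff.rfl

theorem mem_link (K : PreAbstractSimplicialComplex V) (x : V) [DecidableEq V] (σ : Finset V) :
    σ ∈ link K x ↔ σ.Nonempty ∧ x ∉ σ ∧ insert x σ ∈ K := by
  have : σ ∈ link K x ↔ σ.Nonempty ∧ x ∉ σ ∧ (@insert _ _ (@Finset.instInsert V (Classical.decEq V)) x σ) ∈ K := by
    constructor
    · rintro ⟨h1, h2, h3⟩; exact ⟨h1, h2, by convert h3⟩
    · rintro ⟨h1, h2, h3⟩; exact ⟨h1, h2, by convert h3⟩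
  rw [this]
  constructor <;> rintro ⟨h1, h2, h3⟩ <;> exact ⟨h1, h2, by convert h3⟩

open Classical in
theorem singleton_mem_map {f : W → V} (K : PreAbstractSimplicialComplex W) {y : V} :
    {y} ∈ K.map f ↔ ∃ w, f w = y ∧ {w} ∈ K := by
  rw [mem_map_iff]
  constructor
  · rintro ⟨σ, hσ, h⟩
    obtain ⟨w, hw⟩ := (K.isRelLowerSet_faces hσ).1
    refine ⟨w, ?_, (K.isRelLowerSet_faces hσ).2 (by simpa using hw) (Finset.singleton_nonempty w)⟩
    have := Finset.mem_image_of_mem f hw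
    rw [h] at this; simpa using this
  · rintro ⟨w, rfl, h⟩; exact ⟨_, h, by simp⟩

open Classical in
theorem link_map {f : W → V} (hf : f.Injective) (K : PreAbstractSimplicialComplex W) (x : W) :
    link (K.map f) (f x) = (link K x).map f := by
  apply complex_ext; intro τ
  rw [mem_map_iff, mem_link, mem_map_iff]
  constructor
  · rintro ⟨h1, h2, σ, hσ, h3⟩
    have hx : x ∈ σ := by
      have : f x ∈ σ.image f := by rw [h3]; simp
      simpa [hf.eq_iff] using this
    have e : (σ.erase x).image f = τ := by
      rw [Finset.image_erase hf, h3, Finset.erase_insert h2]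
    refine ⟨σ.erase x, (mem_link _ _ _).2 ⟨?_, by simp, by rwa [Finset.insert_erase hx]⟩, e⟩
    rw [← e] at h1; exact Finset.image_nonempty.1 h1
  · rintro ⟨σ, hσ, rfl⟩
    obtain ⟨h1, h2, h3⟩ := (mem_link _ _ _).1 hσ
    exact ⟨h1.image f, by simpa [hf.eq_iff] using h2, _, h3, by simp⟩

open Classical in
theorem deletion_map {f : W → V} (hf : f.Injective) (K : PreAbstractSimplicialComplex W) (x : W) :
    deletion (K.map f) (f x) = (deletion K x).map f := by
  apply complex_ext; intro τ
  constructor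
  · rintro ⟨⟨σ, hσ, rfl⟩, h⟩
    exact ⟨σ, ⟨hσ, fun hx => h (Finset.mem_image_of_mem f hx)⟩, rfl⟩
  · rintro ⟨σ, ⟨hσ, h⟩, rfl⟩
    exact ⟨⟨σ, hσ, rfl⟩, by simpa [hf.eq_iff] using h⟩

open Classical in
theorem contractible_map {f : W → V} (hf : f.Injective) (K : PreAbstractSimplicialComplex W) :
    IsContractibleComplex (K.map f) ↔ IsContractibleComplex K := by
  constructor
  · intro h
    generalize hL : K.map f = L at h
    induction h generalizing K with
    | point L x h =>
      subst hL
      obtain ⟨w, rfl, hw⟩ := (singleton_mem_map K).1 ((h {x}).2 rfl)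
      refine .point K w fun σ => ⟨fun hσ => ?_, fun h => h ▸ hw⟩
      have := (h (σ.image f)).1 ⟨σ, hσ, rfl⟩
      apply Finset.image_injective hf; simpa using this
    | step L x hx h1 h2 ih1 ih2 =>
      subst hL
      obtain ⟨w, rfl, hw⟩ := (singleton_mem_map K).1 hx
      exact .step K w hw (ih1 _ (link_map hf K w).symm) (ih2 _ (deletion_map hf K w).symm)
  · intro h
    induction h with
    | point K x h =>
      refine .point _ (f x) fun σ => ?_
      rw [mem_map_iff]
      constructor
      · rintro ⟨τ, hτ, rfl⟩; rw [(h τ).1 hτ]; simp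
      · rintro rfl; exact ⟨{x}, (h _).2 rfl, by simp⟩
    | step K x hx h1 h2 ih1 ih2 =>
      refine .step _ (f x) ((singleton_mem_map K).2 ⟨x, rfl, hx⟩) ?_ ?_
      · rwa [link_map hf]
      · rwa [deletion_map hf]

open Classical in
theorem sphere_map {f : W → V} (hf : f.Injective) (d : ℤ) (K : PreAbstractSimplicialComplex W) :
    IsSphereComplex d (K.map f) ↔ IsSphereComplex d K := by
  constructor
  · intro h
    generalize hL : K.map f = L at h
    induction h generalizing K with
    | empty L h =>
      subst hL
      exact .empty K fun σ hσ => h _ ⟨σ, hσ, rfl⟩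
    | step d hd L h x hxK hx ih =>
      subst hL
      obtain ⟨w, rfl, hw⟩ := (singleton_mem_map K).1 hxK
      refine .step d hd K (fun y hy => ih (f y) ((singleton_mem_map K).2 ⟨y, rfl, hy⟩) _
        (link_map hf K y).symm) w hw ?_
      rwa [deletion_map hf, contractible_map hf] at hx
  · intro h
    induction h with
    | empty K h =>
      refine .empty _ ?_
      rintro σ ⟨τ, hτ, rfl⟩; exact h _ hτ
    | step d hd K h x hxK hx ih =>
      refine .step d hd _ ?_ (f x) ((singleton_mem_map K).2 ⟨x, rfl, hxK⟩) ?_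
      · intro y hy
        obtain ⟨w, rfl, hw⟩ := (singleton_mem_map K).1 hy
        rw [link_map hf]; exact ih w hw
      · rwa [deletion_map hf, contractible_map hf]

theorem singleton_mem_whitney (G : SimpleGraph V) (x : V) : {x} ∈ whitney G :=
  ⟨Finset.singleton_nonempty x, by simp⟩

open Classical in
theorem link_whitney (G : SimpleGraph V) (x : V) :
    link (whitney G) x = (whitney (unitSphere G x)).map Subtype.val := by
  apply complex_ext; intro τ
  rw [mem_link, mem_map_iff]
  constructor
  · rintro ⟨h1, h2, -, h3⟩
    have hadj : ∀ y ∈ τ, y ∈ G.neighborSet x := fun y hy =>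
      h3 (by simp) (by simp [hy]) (by rintro rfl; exact h2 hy)
    have e : (τ.subtype (· ∈ G.neighborSet x)).image Subtype.val = τ := by
      ext y; simp; exact fun hy => hadj y hy
    refine ⟨τ.subtype (· ∈ G.neighborSet x), ⟨?_, ?_⟩, e⟩
    · rw [← e] at h1; exact Finset.image_nonempty.1 h1
    · intro a ha b hb hab
      exact h3 (by simp at ha; simp [ha]) (by simp at hb; simp [hb]) (fun h => hab (Subtype.ext h))
  · rintro ⟨σ, ⟨h1, h2⟩, rfl⟩
    refine ⟨h1.image _, ?_, Finset.insert_nonempty _ _, ?_⟩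
    · intro hx
      obtain ⟨a, ha, h⟩ := Finset.mem_image.1 hx
      have := a.2; rw [h] at this; exact G.loopless.irrefl x this
    · rw [Finset.coe_insert, SimpleGraph.isClique_insert]
      refine ⟨?_, ?_⟩
      · intro a ha b hb hab
        simp only [Finset.coe_image, Set.mem_image] at ha hb
        obtain ⟨a, ha, rfl⟩ := ha
        obtain ⟨b, hb, rfl⟩ := hb
        exact h2 ha hb (fun h => hab (congrArg _ h))
      · intro b hb _
        simp only [Finset.coe_image, Set.mem_image] at hb
        obtain ⟨b, hb, rfl⟩ := hb
        exact b.2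

open Classical in
theorem deletion_whitney (G : SimpleGraph V) (x : V) :
    deletion (whitney G) x = (whitney (removeVertex G x)).map Subtype.val := by
  apply complex_ext; intro τ
  rw [mem_map_iff]
  constructor
  · rintro ⟨⟨h1, h3⟩, h2⟩
    have e : (τ.subtype (· ∈ ({x}ᶜ : Set V))).image Subtype.val = τ := by
      ext y; simp; rintro hy rfl; exact h2 hy
    refine ⟨τ.subtype (· ∈ ({x}ᶜ : Set V)), ⟨?_, ?_⟩, e⟩
    · rw [← e] at h1; exact Finset.image_nonempty.1 h1
    · intro a ha b hb hab
      exact h3 (by simpa using ha) (by simpa using hb) (fun h => hab (Subtype.ext h))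
  · rintro ⟨σ, ⟨h1, h2⟩, rfl⟩
    refine ⟨⟨h1.image _, ?_⟩, ?_⟩
    · intro a ha b hb hab
      simp only [Finset.coe_image, Set.mem_image] at ha hb
      obtain ⟨a, ha, rfl⟩ := ha
      obtain ⟨b, hb, rfl⟩ := hb
      exact h2 ha hb (fun h => hab (congrArg _ h))
    · intro hx
      obtain ⟨a, ha, h⟩ := Finset.mem_image.1 hx
      exact a.2 h

/-- A graph is contractible if and only if its Whitney complex is. -/
theorem contractible_whitney (G : SimpleGraph V) :
    IsContractibleComplex (whitney G) ↔ IsContractible G := by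
  classical
  constructor
  · intro h
    generalize hL : whitney G = L at h
    suffices H : ∀ (W : Type u) (G : SimpleGraph W) (f : W → V), f.Injective →
        (whitney G).map f = L → IsContractible G by
      refine H V G id Function.injective_id ?_
      rw [← hL]; apply complex_ext; intro τ
      simp [mem_map_iff]
    clear hL G
    induction h with
    | point L x h =>
      intro W G f hf hL; subst hL
      obtain ⟨w, rfl, hw⟩ := (singleton_mem_map _).1 ((h {x}).2 rfl)
      refine .point G w fun y => hf ?_
      simpa using (h {f y}).1 ((singleton_mem_map _).2 ⟨y, rfl, singleton_mem_whitney G y⟩)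
    | step L x hx h1 h2 ih1 ih2 =>
      intro W G f hf hL; subst hL
      obtain ⟨w, rfl, hw⟩ := (singleton_mem_map _).1 hx
      have comp : ∀ {U : Type u} (g : U → W) (K : PreAbstractSimplicialComplex U),
          K.map (f ∘ g) = (K.map g).map f := by
        intro U g K; apply complex_ext; intro τ
        simp [mem_map_iff, Finset.image_image]
      refine .step G w (ih1 _ _ (f ∘ Subtype.val) (hf.comp Subtype.val_injective) ?_)
        (ih2 _ _ (f ∘ Subtype.val) (hf.comp Subtype.val_injective) ?_)
      · rw [link_map hf, link_whitney, comp]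
      · rw [deletion_map hf, deletion_whitney, comp]
  · intro h
    induction h with
    | @point V G x h =>
      refine .point _ x fun σ => ⟨?_, ?_⟩
      · rintro ⟨⟨a, ha⟩, -⟩
        ext y; rw [h y, ← h a]; simp [ha]
      · rintro rfl; exact singleton_mem_whitney G x
    | step G x h1 h2 ih1 ih2 =>
      refine .step _ x (singleton_mem_whitney G x) ?_ ?_
      · rw [link_whitney, contractible_map Subtype.val_injective]; exact ih1 
      · rw [deletion_whitney, contractible_map Subtype.val_injective]; exact ih2

/-- A graph is a `d`-sphere if and only if its Whitney complex is. -/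
theorem sphere_whitney (d : ℤ) (G : SimpleGraph V) :
    IsSphereComplex d (whitney G) ↔ IsSphere d G := by
  classical
  constructor
  · intro h
    generalize hL : whitney G = L at h
    suffices H : ∀ (W : Type u) (G : SimpleGraph W) (f : W → V), f.Injective →
        (whitney G).map f = L → IsSphere d G by
      refine H V G id Function.injective_id ?_
      rw [← hL]; apply complex_ext; intro τ
      simp [mem_map_iff]
    clear hL G
    induction h with
    | empty L h =>
      intro W G f hf hL; subst hL
      exact .empty G ⟨fun y => h _ ((singleton_mem_map _).2 ⟨y, rfl, singleton_mem_whitney G y⟩)⟩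
    | step d hd L h x hxK hx ih =>
      intro W G f hf hL; subst hL
      obtain ⟨w, rfl, hw⟩ := (singleton_mem_map _).1 hxK
      have comp : ∀ {U : Type u} (g : U → W) (K : PreAbstractSimplicialComplex U),
          K.map (f ∘ g) = (K.map g).map f := by
        intro U g K; apply complex_ext; intro τ
        simp [mem_map_iff, Finset.image_image]
      refine .step d hd G (fun y => ih (f y) ((singleton_mem_map _).2
        ⟨y, rfl, singleton_mem_whitney G y⟩) _ _ (f ∘ Subtype.val)
        (hf.comp Subtype.val_injective) ?_) w ?_
      · rw [link_map hf, link_whitney, comp]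
      · rwa [deletion_map hf, contractible_map hf, deletion_whitney,
          contractible_map Subtype.val_injective, contractible_whitney] at hx
  · intro h
    induction h with
    | empty G h =>
      exact .empty _ (by rintro σ ⟨⟨a, -⟩, -⟩; exact h.elim a)
    | step d hd G h x hx ih =>
      refine .step d hd _ (fun y _ => ?_) x (singleton_mem_whitney G x) ?_
      · rw [link_whitney, sphere_map Subtype.val_injective]; exact ih y
      · rw [deletion_whitney, contractible_map Subtype.val_injective, contractible_whitney]
        exact hx

/-- A graph is a `d`-manifold if and only if its Whitney complex is. -/
theorem manifold_whitney (d : ℤ) (G : SimpleGraph V) :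
    IsManifoldComplex d (whitney G) ↔ IsManifold d G := by
  classical
  refine forall_congr' fun x => ?_
  rw [link_whitney, sphere_map Subtype.val_injective, sphere_whitney]
  simp [singleton_mem_whitney]
end Agreement

end Fisk

/-!
The theorem is local: the link of a vertex `x` in the Fisk variety `O(M)` is the Fisk variety
`O(S(x))` of the unit sphere (`Fisk.link_fiskVariety`). Indeed `y ↦ y ∪ {x}` is a bijection from
the simplices of `S(x)` onto the simplices of `M` containing `x`, and it preserves dual circles,
because the vertices of `S(x)` adjacent to all of `y` are exactly the vertices of `M` adjacent to
all of `y ∪ {x}`. So it matches the odd simplices of `S(x)` with the odd simplices of `M` through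
`x` (`Fisk.isOddSimplex_unitSphere_iff`).

Hence `O(M)` is a `(d-2)`-manifold if and only if `O(S(x))` is a `(d-3)`-sphere for every vertex
`x` of `O(M)`. If `x` is not a vertex of `O(M)`, no odd simplex contains `x`, so `O(S(x))` is
empty. Conversely, if `x` is a vertex of `O(M)` and `O(S(x))` is empty, then `{x}` itself is an odd
simplex, so `d = 2` and the empty complex `O(S(x))` is a `(d-3)`-sphere.
-/

namespace Fisk

variable {V : Type u}

open Classical in
theorem dualSphere_insert_image (G : SimpleGraph V) (x : V) (y : Finset (G.neighborSet x)) :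
    dualSphere G (insert x (y.image Subtype.val)) =
      Subtype.val '' dualSphere (unitSphere G x) y := by
  ext z
  simp only [dualSphere, Set.mem_ofPred_eq, Finset.mem_insert, Finset.mem_image, Set.mem_image]
  constructor
  · intro h
    exact ⟨⟨z, h x (.inl rfl)⟩, fun v hv => h v (.inr ⟨v, hv, rfl⟩), rfl⟩
  · rintro ⟨w, hw, rfl⟩ v (rfl | ⟨v, hv, rfl⟩)
    · exact w.2
    · exact hw v hv

open Classical in
theorem isClique_insert_image_iff (G : SimpleGraph V) (x : V) (y : Finset (G.neighborSet x)) :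
    G.IsClique (insert x (y.image Subtype.val) : Finset V) ↔
      (unitSphere G x).IsClique (y : Set (G.neighborSet x)) := by
  rw [Finset.coe_insert, SimpleGraph.isClique_insert]
  constructor
  · rintro ⟨h, -⟩ a ha b hb hab
    exact h (Finset.mem_coe.2 (Finset.mem_image_of_mem _ ha))
      (Finset.mem_coe.2 (Finset.mem_image_of_mem _ hb)) fun e => hab (Subtype.ext e)
  · intro h
    simp only [Finset.coe_image]
    refine ⟨?_, ?_⟩
    · rintro _ ⟨a, ha, rfl⟩ _ ⟨b, hb, rfl⟩ hab
      exact h ha hb fun e => hab (congrArg _ e)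
    · rintro _ ⟨b, -, rfl⟩ -
      exact b.2

theorem notMem_image_neighborSet [DecidableEq V] (G : SimpleGraph V) (x : V)
    (y : Finset (G.neighborSet x)) : x ∉ y.image Subtype.val := by
  intro h
  obtain ⟨a, -, ha⟩ := Finset.mem_image.1 h
  have := a.2
  rw [ha] at this
  exact G.loopless.irrefl x this

open Classical in
/-- The odd simplices of the unit sphere `S(x)` are the odd simplices through `x` with `x`
removed. -/
theorem isOddSimplex_unitSphere_iff (d : ℤ) (G : SimpleGraph V) (x : V)
    (y : Finset (G.neighborSet x)) :
    IsOddSimplex (d - 1) (unitSphere G x) y ↔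
      IsOddSimplex d G (insert x (y.image Subtype.val)) := by
  unfold IsOddSimplex
  rw [isClique_insert_image_iff, dualSphere_insert_image,
    Set.ncard_image_of_injective _ Subtype.val_injective,
    Finset.card_insert_of_notMem (notMem_image_neighborSet G x y),
    Finset.card_image_of_injective _ Subtype.val_injective]
  push_cast
  rw [eq_sub_iff_add_eq]

open Classical in
theorem IsOddSimplex.exists_unitSphere {d : ℤ} {G : SimpleGraph V} {z : Finset V}
    (hz : IsOddSimplex d G z) {x : V} (hx : x ∈ z) :
    ∃ y : Finset (G.neighborSet x), IsOddSimplex (d - 1) (unitSphere G x) y ∧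
      insert x (y.image Subtype.val) = z := by
  have hadj : ∀ v ∈ z.erase x, v ∈ G.neighborSet x := fun v hv =>
    hz.1 (by simpa using hx) (by simpa using Finset.mem_of_mem_erase hv)
      (Finset.ne_of_mem_erase hv).symm
  have e : ((z.erase x).subtype (· ∈ G.neighborSet x)).image Subtype.val = z.erase x := by
    ext v; simpa using fun hv hv' => by simpa using hadj v (by simp [hv, hv'])
  have e' := congrArg (insert x) e
  rw [Finset.insert_erase hx] at e'
  exact ⟨_, (isOddSimplex_unitSphere_iff d G x _).2 (e'.symm ▸ hz), e'⟩

theorem singleton_mem_fiskVariety {d : ℤ} {G : SimpleGraph V} {x : V} :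
    {x} ∈ fiskVariety d G ↔ ∃ z, IsOddSimplex d G z ∧ x ∈ z := by
  constructor
  · rintro ⟨-, z, hz, h⟩
    exact ⟨z, hz, Finset.singleton_subset_iff.1 h⟩
  · rintro ⟨z, hz, h⟩
    exact ⟨Finset.singleton_nonempty x, z, hz, Finset.singleton_subset_iff.2 h⟩

open Classical in
/-- The unit sphere of `x` in the Fisk variety of `G` is the Fisk variety of the unit sphere of
`x` in `G`. If `x` is not a vertex of the Fisk variety, both are empty. -/
theorem link_fiskVariety (d : ℤ) (G : SimpleGraph V) (x : V) :
    link (fiskVariety d G) x = (fiskVariety (d - 1) (unitSphere G x)).map Subtype.val := by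
  apply complex_ext; intro τ
  rw [mem_link, mem_map_iff]
  constructor
  · rintro ⟨hne, hx, -, z, hz, hτ⟩
    obtain ⟨y, hy, rfl⟩ := hz.exists_unitSphere (hτ (Finset.mem_insert_self x τ))
    have hsub : τ ⊆ y.image Subtype.val := fun v hv =>
      Finset.mem_of_mem_insert_of_ne (hτ (Finset.mem_insert_of_mem hv))
        (by rintro rfl; exact hx hv)
    obtain ⟨σ, hσ, rfl⟩ := Finset.subset_image_iff.1 hsub
    exact ⟨σ, ⟨Finset.image_nonempty.1 hne, y, hy, hσ⟩, rfl⟩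
  · rintro ⟨σ, ⟨hne, y, hy, hσ⟩, rfl⟩
    refine ⟨hne.image _, notMem_image_neighborSet G x σ, Finset.insert_nonempty _ _, _,
      (isOddSimplex_unitSphere_iff d G x y).1 hy,
      Finset.insert_subset_insert x (Finset.image_subset_image hσ)⟩

theorem isSphereComplex_link_fiskVariety_iff (d k : ℤ) (G : SimpleGraph V) (x : V) :
    IsSphereComplex k (link (fiskVariety d G) x) ↔
      IsSphereComplex k (fiskVariety (d - 1) (unitSphere G x)) := by
  rw [link_fiskVariety, sphere_map Subtype.val_injective]

/-- If `O(S(x))` is empty for a vertex `x` of `O(G)`, then `{x}` is an odd simplex, which forces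
the dimension to be `2`. -/
theorem eq_two_of_fiskVariety_unitSphere_empty {d : ℤ} {G : SimpleGraph V} {x : V}
    (hx : {x} ∈ fiskVariety d G) (h : ∀ σ, σ ∉ fiskVariety (d - 1) (unitSphere G x)) : d = 2 := by
  obtain ⟨z, hz, hxz⟩ := singleton_mem_fiskVariety.1 hx
  obtain ⟨y, hy, -⟩ := hz.exists_unitSphere hxz
  obtain rfl | hne := y.eq_empty_or_nonempty
  · have := hy.2.1
    simp only [Finset.card_empty, Nat.cast_zero] at this
    omega
  · exact (h y ⟨hne, y, hy, Finset.Subset.refl y⟩).elim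

theorem singleton_mem_fiskVariety_of_mem_unitSphere {d : ℤ} {G : SimpleGraph V} {x : V}
    {σ : Finset (G.neighborSet x)} (h : σ ∈ fiskVariety (d - 1) (unitSphere G x)) :
    {x} ∈ fiskVariety d G := by
  classical
  obtain ⟨-, y, hy, -⟩ := h
  exact singleton_mem_fiskVariety.2
    ⟨_, (isOddSimplex_unitSphere_iff d G x y).1 hy, Finset.mem_insert_self _ _⟩

end Fisk

/-- Let `M` be a `d`-manifold. The Fisk varieties `O(S(x))` of all unit spheres are empty or
`(d-3)`-spheres if and only if the Fisk variety `O(M)` is a `(d-2)`-manifold. -/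
theorem mainTheorem4 {V : Type*} [Finite V] (d : ℤ) (hd : 2 ≤ d) (M : SimpleGraph V)
    (hM : Fisk.IsManifold d M) :
    (∀ x : V, (∀ σ, σ ∉ Fisk.fiskVariety (d - 1) (Fisk.unitSphere M x)) ∨
        Fisk.IsSphereComplex (d - 3) (Fisk.fiskVariety (d - 1) (Fisk.unitSphere M x))) ↔
      Fisk.IsManifoldComplex (d - 2) (Fisk.fiskVariety d M) := by
  have hdim : d - 2 - 1 = d - 3 := by ring
  constructor
  · intro h x hx
    rw [Fisk.isSphereComplex_link_fiskVariety_iff, hdim]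
    rcases h x with h | h
    · obtain rfl := Fisk.eq_two_of_fiskVariety_unitSphere_empty hx h
      exact .empty _ h
    · exact h
  · intro h x
    by_cases hx : {x} ∈ Fisk.fiskVariety d M
    · have := h x hx
      rw [Fisk.isSphereComplex_link_fiskVariety_iff, hdim] at this
      exact .inr this
    · exact .inl fun σ hσ => hx (Fisk.singleton_mem_fiskVariety_of_mem_unitSphere hσ)
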